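/- **Setting.** Let $K$ be a finite field. An $[n,k,\alpha]$ vector code over $K$ is given by a generator matrix $G\in K^{\alpha k\times\alpha n}$; a message consists of $k$ symbols and a codeword $\mathcal C(m)=mG$ of $n$ symbols, each symbol being a vector of $\alpha$ subsymbols in $K$. The code is MDS if every message can be decoded from any $k$ symbols of its codeword. Fix integers $\lambda\ge 2$, $1\le r^F\le k^F$, $r^I\ge 0$, and put $k^I=\lambda k^F$, $n^I=k^I+r^I$, $n^F=k^F+r^F$. Split a message $m\in K^{\alpha k^I}$ into $\lambda$ consecutive parts $m_1,\dots,m_\lambda\in K^{\alpha k^F}$. A *stable MDS convertible code* (in the split regime, with these parameters) consists of an MDS $[n^I,k^I,\alpha]$ code $\mathcal C^I$, an MDS $[n^F,k^F,\alpha]$ code $\mathcal C^F$, and a conversion procedure that turns $\mathcal C^I(m)$ into $\mathcal C^F(m_1),\dots,\mathcal C^F(m_\lambda)$: for each $i$, $k^F$ initial symbols are retained unchanged in $\mathcal C^F(m_i)$ ($\lambda k^F$ distinct *unchanged* symbols in all; the other $r^I$ initial symbols are *retired*), from each initial symbol $s$ a number $\beta(s)$ of elements of $K$, depending only on the content of $s$,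 is downloaded, and the $r^F$ new symbols of each final codeword are computed from all the downloaded data. The read bandwidth is $\gamma_R=\sum_s\beta(s)$ and the conversion bandwidth is $\gamma=\gamma_R+\lambda r^F\alpha$. Let $\beta_1$ and $\beta_2$ be the average amounts downloaded from an unchanged and from a retired symbol. The conjectured inequality is $$\lambda\beta_1\ \ge\ (\lambda-1)\beta_2 .\tag{$*$}$$ Put $$L(\alpha)=\begin{cases}\lambda k^F\alpha-r^I\alpha\max\{\tfrac{k^F}{r^F}-1,0\}& r^I\le\lambda r^F,\\ \lambda\min\{r^F,k^F\}\alpha&\text{otherwise,}\end{cases}\qquad T(\alpha)=\lambda r^F\alpha\,\frac{(\lambda-1)k^F+r^I}{(\lambda-1)r^F+r^I}.$$ **Construction.** Let $r=\max\{r^I,r^F\}$ and $\xi_1,\dots,\xi_r\in K$ be such that the *base code*, the systematic scalar $[k^I+r,k^I]$ code whose parity $t$ has encoding vector $(1,\xi_t,\dots,\xi_t^{k^I-1})$, is MDS. Let $p^{(i)}_{t,\ell}\in K^{\alpha k^I}$ ($i\in[\lambda]$, $t\in[r]$, $\ell\in[\alpha]$) have entry $\xi_t^{a-1}$ at subsymbol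 $\ell$ of message symbol $a$ for $(i-1)k^F<a\le ik^F$, and $0$ elsewhere. Identify $p^{(1)}_{t,\ell}$ also with its restriction to $K^{\alpha k^F}$. For $\ell\le\lambda r^F$ write $\ell=(\ell_1-1)r^F+\ell_2$ with $\ell_1\in[\lambda]$, $\ell_2\in[r^F]$, and let $\vec\ell(i)=((\ell_1-i)\bmod\lambda)\,r^F+\ell_2$. All codes below are systematic, with $q^I_{t,\ell}$ and $q^F_{t,\ell}$ the encoding vectors of subsymbol $\ell$ of parity $t$ of the initial code ($t\in[r^I]$) and of the final code ($t\in[r^F]$). * *Case $r^I>r^F$.* $\alpha=(\lambda-1)r^F+r^I$. For $\ell\le\lambda r^F$: $q^F_{t,\ell}=p^{(1)}_{t,\ell}$, and $q^I_{t,\ell}=\sum_i p^{(i)}_{t,\vec\ell(i)}$ if $t\le r^F$, while $q^I_{t,\ell}=\sum_i p^{(i)}_{t,\vec\ell(i)}+(\xi_t/\xi_{\ell_2})^{(\ell_1-1)k^F}\,p^{(\ell_1)}_{\ell_2,(\lambda-1)r^F+t}$ if $t>r^F$. For $\ell>\lambda r^F$: $q^I_{t,\ell}=\sum_i p^{(i)}_{t,\ell}$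 and $q^F_{t,\ell}=p^{(1)}_{t,\ell}+p^{(1)}_{r^F+\ell-\lambda r^F,\;t}$. * *Case $r^I\le r^F$.* $\alpha=\lambda r^F$, $q^F_{t,\ell}=p^{(1)}_{t,\ell}$, and $q^I_{t,\ell}=\sum_i p^{(i)}_{t,\vec\ell(i)}$ if $\ell_2\le r^I$, while $q^I_{t,\ell}=\sum_i p^{(i)}_{t,\vec\ell(i)}+p^{(\ell_1)}_{\ell_2,t}$ if $\ell_2>r^I$. **Theorem.** 1. There is $D_0$ (depending only on $\lambda,k^F,r^I,r^F$) such that for every prime $p$, every $D\ge D_0$, every field $K$ with $p^D$ elements and every generator $\theta$ of $K^\times$, the base code with $\xi_t=\theta^{t-1}$ is MDS. 2. If $r^I>r^F$, then for all $\xi_t$ for which the base code is MDS, the constructed codes, with the data symbols as unchanged symbols, form a stable MDS convertible code whose conversion procedure downloads exactly the $\beta_1=(\lambda-1)r^F$ subsymbols $r^F<\ell\le\lambda r^F$ from each unchanged symbol and the $\beta_2=\lambda r^F$ subsymbols $\ell\le\lambda r^F$ from each retired symbol. It attains $\gamma_R=T(\alpha)$. Every stable MDS convertible code with the same $(\lambda,k^F,r^I,r^F)$,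 over any finite field and with any $\alpha'\ge1$ subsymbols per symbol, which satisfies $(*)$ has $\gamma_R'\ge T(\alpha')$ and $\gamma'/\alpha'\ge\gamma/\alpha$. Hence the construction is optimal if the conjecture holds, i.e. if $(*)$ may be taken to hold for stable MDS convertible codes. 3. If $r^I\le r^F$, then for all $\xi_t$ for which the base code is MDS, the constructed codes, with the data symbols as unchanged symbols, form a stable MDS convertible code whose conversion procedure downloads exactly the $\beta_1=\lambda r^F-r^I$ subsymbols $\ell>r^I$ from each unchanged symbol and all $\beta_2=\lambda r^F$ subsymbols from each retired symbol. It attains $\gamma_R=L(\alpha)$. Every stable MDS convertible code with the same $(\lambda,k^F,r^I,r^F)$, over any finite field and with any $\alpha'\ge1$, has $\gamma_R'\ge L(\alpha')$ and $\gamma'/\alpha'\ge\gamma/\alpha$. So the construction is unconditionally optimal. -/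

import Mathlib

universe u v

/-- An `[n, k, α]` vector code over `K`, given by its generator matrix.  Row `(j, ℓ)` belongs to
subsymbol `ℓ` of message symbol `j`, column `(s, ℓ)` to subsymbol `ℓ` of code symbol `s`. -/
abbrev VectorCode (K : Type*) (n k α : ℕ) : Type _ :=
  Matrix (Fin k × Fin α) (Fin n × Fin α) K

namespace VectorCode

variable {K : Type*} [Field K] {n k α : ℕ}

/-- The codeword `m G` of a message `m`, as a family of `n` symbols of `α` subsymbols. -/
def encode (G : VectorCode K n k α) (m : Fin k × Fin α → K) : Fin n → Fin α → K :=
  fun s ℓ => Matrix.vecMul m G (s, ℓ)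

/-- Maximum distance separable: every message can be decoded from any `k` code symbols. -/
def IsMDS (G : VectorCode K n k α) : Prop :=
  ∀ S : Finset (Fin n), S.card = k → ∀ m m' : Fin k × Fin α → K,
    (∀ s ∈ S, G.encode m s = G.encode m' s) → m = m'

/-- The systematic code `[I | P]` with `r` parity symbols, where `q t ℓ` is the encoding vector
(a column of `P`) of subsymbol `ℓ` of parity `t`. -/
def systematic {r : ℕ} (q : Fin r → Fin α → (Fin k × Fin α → K)) : VectorCode K (k + r) k α :=
  Matrix.of fun x y =>
    Fin.addCases (motive := fun _ => K)
      (fun j => if x = (j, y.2) then 1 else 0) (fun t => q t y.2 x) y.1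

end VectorCode

/-- The part of a message that is associated with final codeword `i`: the `i`-th of `lam`
consecutive groups of `kF` message symbols. -/
def messagePart {K : Type*} {lam kF α : ℕ} (m : Fin (lam * kF) × Fin α → K) (i : Fin lam) :
    Fin kF × Fin α → K :=
  fun x => m (finProdFinEquiv (i, x.1), x.2)

/-- A stable convertible code in the split regime, with parameters
`(lam * kF + rI, lam * kF; kF + rF, kF)`: an initial code, a final code, and a conversion
procedure taking the initial codeword of each message `m` to the final codewords of the `lam`
parts of `m`. Each final codeword retains `kF` initial symbols; its `rF` new symbols are computed
from the downloaded data, where `amount s` elements of `K` that depend only on the content of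
initial symbol `s` are downloaded from `s`. -/
structure StableSplitCode (K : Type*) [Field K] (lam kF rI rF α : ℕ) where
  initialCode : VectorCode K (lam * kF + rI) (lam * kF) α
  finalCode : VectorCode K (kF + rF) kF α
  /-- The initial symbols that are retained in final codeword `i`. -/
  unchanged : Fin lam → Fin kF → Fin (lam * kF + rI)
  /-- The places of the retained symbols in final codeword `i`. -/
  place : Fin lam → Fin kF → Fin (kF + rF)
  unchanged_injective : Function.Injective (Function.uncurry unchanged)
  place_injective : ∀ i, Function.Injective (place i)
  /-- The amount of data downloaded from each initial symbol. -/
  amount : Fin (lam * kF + rI) → ℕ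
  download : ∀ s, (Fin α → K) → (Fin (amount s) → K)
  /-- Computes the new symbols from the downloads (values at retained places are not used). -/
  newSymbol : (∀ s, Fin (amount s) → K) → Fin lam → Fin (kF + rF) → Fin α → K
  unchanged_correct : ∀ m i j,
    finalCode.encode (messagePart m i) (place i j) = initialCode.encode m (unchanged i j)
  new_correct : ∀ m i s, s ∉ Set.range (place i) →
    newSymbol (fun u => download u (initialCode.encode m u)) i s =
      finalCode.encode (messagePart m i) s

namespace StableSplitCode

variable {K : Type*} [Field K] {lam kF rI rF α : ℕ} (C : StableSplitCode K lam kF rI rF α)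

/-- Both the initial and the final code are MDS. -/
def IsMDS : Prop := C.initialCode.IsMDS ∧ C.finalCode.IsMDS

/-- An initial symbol is retired if it is retained in no final codeword. -/
def IsRetired (s : Fin (lam * kF + rI)) : Prop := ∀ i j, C.unchanged i j ≠ s

/-- The data downloaded from all the unchanged symbols. -/
def readUnchanged : ℕ := ∑ i, ∑ j, C.amount (C.unchanged i j)

open Classical in
/-- The data downloaded from all the retired symbols. -/
noncomputable def readRetired : ℕ := ∑ s with C.IsRetired s, C.amount s

/-- The read conversion bandwidth. -/
def readBandwidth : ℕ := ∑ s, C.amount s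

/-- The conversion bandwidth: the data that is read, plus the data written to the `rF` new symbols
of each of the `lam` final codewords. -/
def bandwidth : ℕ := C.readBandwidth + lam * rF * α

/-- The conjectured inequality `lam * β₁ ≥ (lam - 1) * β₂`, where `β₁` is the (average) amount
downloaded from an unchanged symbol, and `β₂` from a retired symbol. -/
def ConjecturedInequality : Prop :=
  ((lam : ℚ) - 1) * ((C.readRetired : ℚ) / rI) ≤
    (lam : ℚ) * ((C.readUnchanged : ℚ) / (lam * kF : ℕ))

/-- What is downloaded from initial symbol `s` is exactly its subsymbols with index in `S`. -/
def Reads (s : Fin (lam * kF + rI)) (S : Set (Fin α)) : Prop :=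
  ∃ e : Fin (C.amount s) ≃ S, ∀ y, C.download s y = fun x => y (e x)

/-- The codes are systematic in the way that the conversion uses: the unchanged symbols of final
codeword `i` are the initial data symbols of part `i`, and they become its data symbols. -/
def KeepsDataSymbols : Prop :=
  (∀ i j, C.unchanged i j = Fin.castAdd rI (finProdFinEquiv (i, j))) ∧
  (∀ i j, C.place i j = Fin.castAdd rF j)

end StableSplitCode

/-- The lower bound on the read bandwidth of all stable MDS convertible codes. -/
def looseBound (lam kF rI rF α : ℕ) : ℚ :=
  if rI ≤ lam * rF then
    (lam : ℚ) * kF * α - (rI : ℚ) * α * max ((kF : ℚ) / rF - 1) 0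
  else (lam : ℚ) * (min rF kF : ℕ) * α

/-- The lower bound on the read bandwidth that the conjectured inequality leads to. -/
def tightBound (lam kF rI rF α : ℕ) : ℚ :=
  (lam : ℚ) * rF * α * ((((lam : ℚ) - 1) * kF + rI) / (((lam : ℚ) - 1) * rF + rI))

section Construction

/-! All indices start from `0`; the evaluation points are the first terms of a sequence `ξ`. -/

variable {K : Type*} [Field K] (ξ : ℕ → K) (lam kF rI rF : ℕ)

/-- The base code: the systematic scalar code with `k` data symbols whose `r` parities have the
encoding vectors `(1, ξ t, …, ξ t ^ (k - 1))`, `t < r`. -/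
def baseCode (k r : ℕ) : VectorCode K (k + r) k 1 :=
  VectorCode.systematic fun t _ x => ξ t ^ (x.1 : ℕ)

/-- The vector `p^{(i)}_{t,ℓ}` that encodes the data of final codeword `i` (the `i`-th group of
`kF` symbols, out of `k` symbols) in instance `ℓ` under parity `t` of the base code. -/
def partialParity {k α : ℕ} (i t ℓ : ℕ) : Fin k × Fin α → K :=
  fun x => if (x.1 : ℕ) / kF = i ∧ (x.2 : ℕ) = ℓ then ξ t ^ (x.1 : ℕ) else 0

/-- The instance of the data of final codeword `i` that stands at instance `ℓ < lam * rF` when the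
`lam` blocks of `rF` instances are shifted circularly to the right `i` times. -/
def shiftedInstance (ℓ i : ℕ) : ℕ :=
  ((ℓ / rF + lam - i) % lam) * rF + ℓ % rF

/-- Number of subsymbols per symbol in the construction for `rF < rI`. -/
def downAlpha : ℕ := (lam - 1) * rF + rI

/-- Initial code of the construction for `rF < rI`. -/
def downInitial :
    VectorCode K (lam * kF + rI) (lam * kF) (downAlpha lam rI rF) :=
  VectorCode.systematic fun t ℓ =>
    if (ℓ : ℕ) < lam * rF then
      (∑ i : Fin lam, partialParity ξ kF i t (shiftedInstance lam rF ℓ i)) +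
        if (t : ℕ) < rF then 0
        else (ξ t / ξ (ℓ % rF)) ^ ((ℓ : ℕ) / rF * kF) •
          partialParity ξ kF (ℓ / rF) (ℓ % rF) ((lam - 1) * rF + t)
    else ∑ i : Fin lam, partialParity ξ kF i t ℓ

/-- Final code of the construction for `rF < rI`. -/
def downFinal : VectorCode K (kF + rF) kF (downAlpha lam rI rF) :=
  VectorCode.systematic fun t ℓ =>
    if (ℓ : ℕ) < lam * rF then partialParity ξ kF 0 t ℓ
    else partialParity ξ kF 0 t ℓ + partialParity ξ kF 0 (rF + (ℓ - lam * rF)) t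

/-- Number of subsymbols per symbol in the construction for `rI ≤ rF`. -/
def upAlpha : ℕ := lam * rF

/-- Initial code of the construction for `rI ≤ rF`. -/
def upInitial : VectorCode K (lam * kF + rI) (lam * kF) (upAlpha lam rF) :=
  VectorCode.systematic fun t ℓ =>
    (∑ i : Fin lam, partialParity ξ kF i t (shiftedInstance lam rF ℓ i)) +
      if (ℓ : ℕ) % rF < rI then 0
      else partialParity ξ kF (ℓ / rF) (ℓ % rF) t

/-- Final code of the construction for `rI ≤ rF`. -/
def upFinal : VectorCode K (kF + rF) kF (upAlpha lam rF) :=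
  VectorCode.systematic fun t ℓ => partialParity ξ kF 0 t ℓ

end Construction

/-! Large fields: a minor of the matrix `θ ^ (t * x)` is a polynomial in `θ` over the prime field.
By the rearrangement inequality only the identity permutation reaches the exponent `∑ t i * x i`, so
the polynomial is nonzero. Its degree is below `D`, the degree of the minimal polynomial of a
generator `θ`, so the minor does not vanish (`isMDS_baseCode_pow_generator`).

Constructions: by linearity, decoding and conversion are statements about a message on which
everything read is zero. Both codes are instances of the base code with some parities piggybacked on
others. Instances without piggybacks are decoded first; this clears the piggybacks on the rest. For
the conversion, the circular shift leaves only part `i` among the unread low instances in block `i`,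
so the retired symbols yield parities of part `i` alone, and the piggybacks supply the missing final
parities.

Lower bounds: let `rF` unchanged symbols of each final codeword vary freely and fix the others. The
downloads determine the new symbols, hence the free ones, so they carry at least `lam * rF * α`
elements (`new_le_sum_effectiveAmount`). Averaging over the choice gives `kF * (lam * rF * α) ≤ rF *
U + kF * R`, where `U` and `R` are the amounts from unchanged and retired symbols. The loose bound
adds `R ≤ rI * α`, the tight bound adds the conjectured inequality. -/

open Finset

/-! ### Systematic codes and erasure decoding -/

namespace VectorCode

variable {K : Type*} [Field K] {n k α : ℕ}

theorem encode_sub (G : VectorCode K n k α) (m m' : Fin k × Fin α → K) (s : Fin n) :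
    G.encode (m - m') s = G.encode m s - G.encode m' s := by
  funext ℓ
  simp [encode, Matrix.sub_vecMul]

theorem encode_zero (G : VectorCode K n k α) (s : Fin n) : G.encode 0 s = 0 := by
  funext ℓ
  simp [encode]

theorem encode_systematic_castAdd {r : ℕ} (q : Fin r → Fin α → (Fin k × Fin α → K))
    (m : Fin k × Fin α → K) (x : Fin k) (ℓ : Fin α) :
    (systematic q).encode m (Fin.castAdd r x) ℓ = m (x, ℓ) := by
  simp [encode, systematic, Matrix.vecMul, dotProduct]

theorem encode_systematic_natAdd {r : ℕ} (q : Fin r → Fin α → (Fin k × Fin α → K))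
    (m : Fin k × Fin α → K) (t : Fin r) (ℓ : Fin α) :
    (systematic q).encode m (Fin.natAdd k t) ℓ = m ⬝ᵥ q t ℓ := by
  simp [encode, systematic, Matrix.vecMul, dotProduct]

/-- A systematic code is MDS iff no nonzero message, supported on at most as many symbols as there
are parities in some set, has all parities of the set equal to zero. -/
theorem isMDS_systematic_iff {r : ℕ} (q : Fin r → Fin α → (Fin k × Fin α → K)) :
    (systematic q).IsMDS ↔
      ∀ (X : Finset (Fin k)) (T : Finset (Fin r)), X.card ≤ T.card →
        ∀ m : Fin k × Fin α → K, (∀ x ∉ X, ∀ ℓ, m (x, ℓ) = 0) →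
          (∀ t ∈ T, ∀ ℓ, m ⬝ᵥ q t ℓ = 0) → m = 0 := by
  classical
  constructor
  · intro h X T hXT m hX hT
    -- The data symbols outside `X` and the parities in `T` all vanish. They number at least `k`, so
    -- some `k` of them decode `m` to zero.
    set S : Finset (Fin (k + r)) :=
      (Xᶜ).map (Fin.castAddEmb r) ∪ T.map (Fin.natAddEmb k) with hS
    have hdisj : Disjoint ((Xᶜ).map (Fin.castAddEmb r)) (T.map (Fin.natAddEmb k)) := by
      rw [Finset.disjoint_left]
      intro s hs hs'
      simp only [Finset.mem_map] at hs hs'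
      obtain ⟨x, -, rfl⟩ := hs
      obtain ⟨t, -, ht⟩ := hs'
      have := congrArg Fin.val ht
      simp at this
      omega
    have hcard : k ≤ S.card := by
      rw [hS, Finset.card_union_of_disjoint hdisj, Finset.card_map, Finset.card_map,
        Finset.card_compl, Fintype.card_fin]
      omega
    obtain ⟨S', hS'S, hS'⟩ := Finset.exists_subset_card_eq hcard
    refine h S' hS' m 0 fun s hs => ?_
    rw [encode_zero]
    have := hS'S hs
    rw [hS, Finset.mem_union, Finset.mem_map, Finset.mem_map] at this
    funext ℓ
    rcases this with ⟨x, hx, rfl⟩ | ⟨t, ht, rfl⟩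
    · rw [Fin.castAddEmb_apply, encode_systematic_castAdd, hX x (by simpa using hx)]
      rfl
    · rw [Fin.natAddEmb_apply, encode_systematic_natAdd, hT t ht]
      rfl
  · intro h S hS m m' hmm
    rw [← sub_eq_zero]
    generalize hd : m - m' = d
    have hz : ∀ s ∈ S, (systematic q).encode d s = 0 := fun s hs => by
      rw [← hd, encode_sub, hmm s hs, sub_self]
    -- The erased data symbols and the available parities; they are equally many because `S` has `k`
    -- elements.
    refine h (univ.filter fun x => Fin.castAdd r x ∉ S) (univ.filter fun t => Fin.natAdd k t ∈ S)
      ?_ d ?_ ?_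
    · have h1 : S.card = (univ.filter fun x : Fin k => Fin.castAdd r x ∈ S).card +
          (univ.filter fun t => Fin.natAdd k t ∈ S).card := by
        rw [Finset.card_filter, Finset.card_filter, ← Fin.sum_univ_add
          (f := fun s : Fin (k + r) => if s ∈ S then 1 else 0)]
        simp
      have h2 := Finset.card_filter_add_card_filter_not (s := (univ : Finset (Fin k)))
        (fun x => Fin.castAdd r x ∈ S)
      rw [Finset.card_univ, Fintype.card_fin] at h2
      omega
    · intro x hx ℓ
      rw [← encode_systematic_castAdd q d, hz _ (by simpa using hx)]
      rfl
    · intro t ht ℓ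
      rw [← encode_systematic_natAdd q d, hz _ (by simpa using ht)]
      rfl

end VectorCode

/-! ### Conversion procedures for systematic codes -/

theorem messagePart_sub {K : Type*} [Field K] {lam kF α : ℕ} (m m' : Fin (lam * kF) × Fin α → K)
    (i : Fin lam) : messagePart (m - m') i = messagePart m i - messagePart m' i := rfl

namespace StableSplitCode

open VectorCode

variable {K : Type*} [Field K] {lam kF rI rF α : ℕ}

/-- A pair of systematic codes admits a conversion procedure that reads the subsymbols `A` of the
data symbols and the subsymbols `B` of the parities, if those subsymbols of the initial codeword
determine the parities of the final codewords. -/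
theorem exists_of_reads (qI : Fin rI → Fin α → (Fin (lam * kF) × Fin α → K))
    (qF : Fin rF → Fin α → (Fin kF × Fin α → K)) (A B : Finset (Fin α))
    (h : ∀ m : Fin (lam * kF) × Fin α → K, (∀ x, ∀ ℓ ∈ A, m (x, ℓ) = 0) →
      (∀ t, ∀ ℓ ∈ B, m ⬝ᵥ qI t ℓ = 0) → ∀ i t ℓ, messagePart m i ⬝ᵥ qF t ℓ = 0) :
    ∃ C : StableSplitCode K lam kF rI rF α,
      C.initialCode = systematic qI ∧ C.finalCode = systematic qF ∧ C.KeepsDataSymbols ∧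
      (∀ s, ¬ C.IsRetired s → C.amount s = A.card ∧ C.Reads s A) ∧
      (∀ s, C.IsRetired s → C.amount s = B.card ∧ C.Reads s B) ∧
      C.readBandwidth = lam * kF * A.card + rI * B.card := by
  classical
  let R : Fin (lam * kF + rI) → Finset (Fin α) := Fin.addCases (fun _ => A) (fun _ => B)
  let dl : ∀ s, (Fin α → K) → (Fin (R s).card → K) := fun s y x => y ((R s).equivFin.symm x)
  let D : (Fin (lam * kF) × Fin α → K) → ∀ s, Fin (R s).card → K :=
    fun m s => dl s ((systematic qI).encode m s)
  have hD : ∀ m m', D m = D m' → ∀ s, ∀ ℓ ∈ R s,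
      (systematic qI).encode m s ℓ = (systematic qI).encode m' s ℓ := by
    intro m m' hm s ℓ hℓ
    simpa [D, dl] using congrFun (congrFun hm s) ((R s).equivFin ⟨ℓ, hℓ⟩)
  have key : ∀ m m', D m = D m' → ∀ i t,
      (systematic qF).encode (messagePart m i) (Fin.natAdd kF t) =
        (systematic qF).encode (messagePart m' i) (Fin.natAdd kF t) := by
    intro m m' hm i t
    funext ℓ
    rw [encode_systematic_natAdd, encode_systematic_natAdd, ← sub_eq_zero, ← sub_dotProduct,
      ← messagePart_sub]
    refine h _ (fun x ℓ hℓ => ?_) (fun t ℓ hℓ => ?_) i t ℓ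
    · have := hD m m' hm (Fin.castAdd rI x) ℓ (by simpa [R] using hℓ)
      rw [encode_systematic_castAdd, encode_systematic_castAdd] at this
      rw [Pi.sub_apply, this, sub_self]
    · have := hD m m' hm (Fin.natAdd _ t) ℓ (by simpa [R] using hℓ)
      rw [encode_systematic_natAdd, encode_systematic_natAdd] at this
      rw [sub_dotProduct, this, sub_self]
  let C : StableSplitCode K lam kF rI rF α :=
    { initialCode := systematic qI
      finalCode := systematic qF
      unchanged := fun i j => Fin.castAdd rI (finProdFinEquiv (i, j))
      place := fun _ j => Fin.castAdd rF j
      unchanged_injective := by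
        rintro ⟨i, j⟩ ⟨i', j'⟩ hij
        exact finProdFinEquiv.injective (Fin.castAdd_injective _ _ hij)
      place_injective := fun _ => Fin.castAdd_injective _ _
      amount := fun s => (R s).card
      download := dl
      -- Any message with the given downloads serves: by `key` all of them have the same final
      -- parities.
      newSymbol := fun d i s => (systematic qF).encode (messagePart (Function.invFun D d) i) s
      unchanged_correct := by
        intro m i j
        funext ℓ
        rw [encode_systematic_castAdd, encode_systematic_castAdd]
        rfl
      new_correct := by
        intro m i s hs
        have hinv : D (Function.invFun D (D m)) = D m := Function.invFun_eq ⟨m, rfl⟩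
        induction s using Fin.addCases with
        | left x => exact absurd ⟨x, rfl⟩ hs
        | right t => exact key _ _ hinv i t }
  have hleft : ∀ x, ¬ C.IsRetired (Fin.castAdd rI x) := by
    intro x hx
    refine hx (finProdFinEquiv.symm x).1 (finProdFinEquiv.symm x).2 ?_
    simp only [C, Prod.mk.eta, Equiv.apply_symm_apply]
  have hright : ∀ t, C.IsRetired (Fin.natAdd _ t) := by
    intro t i j hij
    have h1 := congrArg Fin.val hij
    have h2 := (finProdFinEquiv (i, j)).isLt
    simp only [C, Fin.val_castAdd, Fin.val_natAdd] at h1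
    omega
  have hreads : ∀ s, C.Reads s (R s) := fun s => ⟨(R s).equivFin.symm, fun y => rfl⟩
  have hl : ∀ x, R (Fin.castAdd rI x) = A := fun x => by simp [R]
  have hr : ∀ t, R (Fin.natAdd _ t) = B := fun t => by simp [R]
  refine ⟨C, rfl, rfl, ⟨fun _ _ => rfl, fun _ _ => rfl⟩, ?_, ?_, ?_⟩
  · intro s hs
    induction s using Fin.addCases with
    | left x =>
      refine ⟨congrArg Finset.card (hl x), ?_⟩
      have := hreads (Fin.castAdd rI x)
      rwa [hl] at this
    | right t => exact absurd (hright t) hs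
  · intro s hs
    induction s using Fin.addCases with
    | left x => exact absurd hs (hleft x)
    | right t =>
      refine ⟨congrArg Finset.card (hr t), ?_⟩
      have := hreads (Fin.natAdd _ t)
      rwa [hr] at this
  · change ∑ s, (R s).card = _
    rw [Fin.sum_univ_add]
    simp only [hl, hr]
    simp

end StableSplitCode

/-! ### Superregularity of the base code -/

/-- All square submatrices of the matrix `ξ t ^ x`, `t < r`, `x < k`, are nonsingular. -/
def Superregular {K : Type*} [Field K] (ξ : ℕ → K) (k r : ℕ) : Prop :=
  ∀ X T : Finset ℕ, (∀ x ∈ X, x < k) → (∀ t ∈ T, t < r) → X.card ≤ T.card →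
    ∀ v : ℕ → K, (∀ t ∈ T, ∑ x ∈ X, v x * ξ t ^ x = 0) → ∀ x ∈ X, v x = 0

theorem isMDS_baseCode_iff {K : Type*} [Field K] {ξ : ℕ → K} {k r : ℕ} :
    (baseCode ξ k r).IsMDS ↔ Superregular ξ k r := by
  classical
  unfold baseCode
  rw [VectorCode.isMDS_systematic_iff]
  have hdot : ∀ (m : Fin k × Fin 1 → K) (t : ℕ),
      (m ⬝ᵥ fun x => ξ t ^ (x.1 : ℕ)) = ∑ x : Fin k, m (x, 0) * ξ t ^ (x : ℕ) := by
    intro m t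
    rw [dotProduct, Fintype.sum_prod_type]
    simp
  constructor
  · intro h X T hX hT hXT v hv x hx
    let X' : Finset (Fin k) := univ.filter fun x => (x : ℕ) ∈ X
    let T' : Finset (Fin r) := univ.filter fun t => (t : ℕ) ∈ T
    have hX' : X'.map Fin.valEmbedding = X := by
      ext y
      simp only [X', Finset.mem_map, Finset.mem_filter, Finset.mem_univ, true_and,
        Fin.valEmbedding_apply]
      exact ⟨fun ⟨a, ha, hay⟩ => hay ▸ ha, fun hy => ⟨⟨y, hX y hy⟩, hy, rfl⟩⟩
    have hT' : T'.map Fin.valEmbedding = T := by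
      ext y
      simp only [T', Finset.mem_map, Finset.mem_filter, Finset.mem_univ, true_and,
        Fin.valEmbedding_apply]
      exact ⟨fun ⟨a, ha, hay⟩ => hay ▸ ha, fun hy => ⟨⟨y, hT y hy⟩, hy, rfl⟩⟩
    have := h X' T' (by rwa [← hX', ← hT', Finset.card_map, Finset.card_map] at hXT)
      (fun y => if (y.1 : ℕ) ∈ X then v y.1 else 0) (fun y hy ℓ => if_neg (by simpa [X'] using hy))
      (fun t ht ℓ => by
        refine Eq.trans ?_ (hv t (by simpa [T'] using ht))
        rw [hdot, ← hX', Finset.sum_map, Finset.sum_filter, hX']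
        refine Finset.sum_congr rfl fun y _ => ?_
        simp only [ite_mul, zero_mul, Fin.valEmbedding_apply])
    simpa [hx] using congrFun this (⟨x, hX x hx⟩, 0)
  · intro h X T hXT m hX hT
    have := h (X.map Fin.valEmbedding) (T.map Fin.valEmbedding)
      (by simp only [Finset.mem_map]; rintro _ ⟨x, -, rfl⟩; exact x.isLt)
      (by simp only [Finset.mem_map]; rintro _ ⟨x, -, rfl⟩; exact x.isLt)
      (by rwa [Finset.card_map, Finset.card_map])
      (fun y => if hy : y < k then m (⟨y, hy⟩, 0) else 0)
      (by
        simp only [Finset.mem_map]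
        rintro _ ⟨t, ht, rfl⟩
        rw [← hT t ht 0, hdot, Finset.sum_map]
        refine Finset.sum_subset_zero_on_sdiff (Finset.subset_univ _) ?_ ?_
        · intro x hx
          rw [hX x (by simpa using hx), zero_mul]
        · intro x hx
          simp)
    funext ⟨x, ℓ⟩
    by_cases hx : x ∈ X
    · have h1 := this x (Finset.mem_map_of_mem Fin.valEmbedding hx)
      rw [Subsingleton.elim ℓ 0]
      simpa using h1
    · exact hX x hx ℓ

/-- The coefficient of a generalized Vandermonde determinant at the exponent that the rearrangement
inequality singles out. -/
theorem coeff_det_X_pow {R : Type*} [CommRing R] {s : ℕ} {t x : Fin s → ℕ} (ht : StrictMono t)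
    (hx : StrictMono x) :
    (Matrix.of fun i j => (Polynomial.X : Polynomial R) ^ (t i * x j)).det.coeff
      (∑ i, t i * x i) = 1 := by
  rw [← Matrix.det_transpose, Matrix.det_apply, Polynomial.finsetSum_coeff,
    Finset.sum_eq_single 1]
  · simp [Finset.prod_pow_eq_pow_sum, Polynomial.coeff_X_pow]
  · intro σ _ hσ
    simp only [Matrix.transpose_apply, Matrix.of_apply, Finset.prod_pow_eq_pow_sum,
      Polynomial.coeff_smul, Polynomial.coeff_X_pow]
    rw [if_neg, smul_zero]
    -- Equality in the rearrangement inequality forces `σ` to be strictly increasing, hence the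
    -- identity.
    have hmono : Monovary t x := fun i j hij => ht.monotone (hx.lt_iff_lt.1 hij).le
    intro heq
    have := (hmono.sum_mul_comp_perm_eq_sum_mul_iff (σ := σ)).1 heq.symm
    have hσm : StrictMono σ := fun i j hij => by
      by_contra! hle
      have hlt := lt_of_le_of_ne hle fun he => hij.ne' (σ.injective he)
      exact absurd (this (hx hlt)) (ht hij).not_ge
    exact hσ (Equiv.ext fun i => congrFun hσm.eq_id i)
  · simp

theorem natDegree_det_X_pow_le {R : Type*} [CommRing R] {s k r : ℕ} {t x : Fin s → ℕ}
    (ht : ∀ i, t i ≤ r) (hx : ∀ i, x i ≤ k) :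
    (Matrix.of fun i j => (Polynomial.X : Polynomial R) ^ (t i * x j)).det.natDegree ≤
      s * (r * k) := by
  rw [Matrix.det_apply]
  refine Polynomial.natDegree_sum_le_of_forall_le _ _ fun σ _ => ?_
  refine (Polynomial.natDegree_smul_le _ _).trans ?_
  simp only [Matrix.of_apply, Finset.prod_pow_eq_pow_sum]
  refine (Polynomial.natDegree_X_pow_le _).trans ?_
  refine (Finset.sum_le_card_nsmul _ _ (r * k) fun i _ => Nat.mul_le_mul (ht _) (hx _)).trans ?_
  simp

/-- Each minor is the value at `θ` of a determinant over `ZMod p` of size at most `k` with entries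
of degree at most `r * k`, nonzero by `coeff_det_X_pow`. -/
theorem superregular_pow_of_forall_aeval_ne_zero {K : Type*} [Field K] {p D k r : ℕ}
    [Fact p.Prime] [Algebra (ZMod p) K] {θ : K} (hD : k * (r * k) < D)
    (hθ : ∀ P : Polynomial (ZMod p), P ≠ 0 → P.natDegree < D → Polynomial.aeval θ P ≠ 0) :
    Superregular (fun t => θ ^ t) k r := by
  intro X T hX hT hXT v hv
  obtain ⟨T', hT'T, hT'⟩ := Finset.exists_subset_card_eq hXT
  let x := X.orderEmbOfFin rfl
  let t := T'.orderEmbOfFin hT'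
  have hxX : ∀ i, x i ∈ X := fun i => Finset.orderEmbOfFin_mem _ _ _
  have htT : ∀ i, t i ∈ T' := fun i => Finset.orderEmbOfFin_mem _ _ _
  have hs : X.card ≤ k := by
    simpa using Finset.card_le_card (show X ⊆ range k from fun y hy => by simpa using hX y hy)
  let P := (Matrix.of fun i j => (Polynomial.X : Polynomial (ZMod p)) ^ (t i * x j)).det
  have hP : P ≠ 0 := fun h0 => by
    have := coeff_det_X_pow (R := ZMod p) t.strictMono x.strictMono
    change P.coeff _ = 1 at this
    rw [h0] at this
    simp at this
  have hdeg : P.natDegree < D :=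
    ((natDegree_det_X_pow_le (fun i => (hT _ (hT'T (htT i))).le) fun i => (hX _ (hxX i)).le).trans
      (Nat.mul_le_mul_right _ hs)).trans_lt hD
  have hdet := hθ P hP hdeg
  have hmap : Polynomial.aeval θ P = (Matrix.of fun i j => θ ^ (t i * x j)).det := by
    rw [AlgHom.map_det]
    congr 1
    ext i j
    simp
  rw [hmap] at hdet
  have hsum : ∀ f : ℕ → K, ∑ y ∈ X, f y = ∑ j, f (x j) := fun f => by
    conv_lhs => rw [← Finset.map_orderEmbOfFin_univ X rfl]
    rw [Finset.sum_map]
    rfl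
  have hz : (fun j => v (x j)) = 0 := by
    refine Matrix.eq_zero_of_mulVec_eq_zero hdet ?_
    funext i
    have := hv (t i) (hT'T (htT i))
    rw [hsum] at this
    rw [Matrix.mulVec, dotProduct, Pi.zero_apply, ← this]
    refine Finset.sum_congr rfl fun j _ => ?_
    rw [Matrix.of_apply, pow_mul, mul_comm]
  intro y hy
  rw [← Finset.mem_coe, ← Finset.range_orderEmbOfFin X rfl] at hy
  obtain ⟨j, rfl⟩ := hy
  exact congrFun hz j

/-- A generator of the unit group also generates `K` as a field, so its minimal polynomial has
degree `D` and divides no nonzero polynomial of smaller degree. -/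
theorem isMDS_baseCode_pow_generator (k r : ℕ) :
    ∃ D₀ : ℕ, ∀ p D : ℕ, p.Prime → D₀ ≤ D →
      ∀ (K : Type u) [Field K] [Finite K], Nat.card K = p ^ D →
      ∀ θ : Kˣ, (∀ x : Kˣ, x ∈ Subgroup.zpowers θ) →
        (baseCode (fun t => (θ : K) ^ t) k r).IsMDS := by
  refine ⟨k * (r * k) + 1, fun p D hp hD K _ _ hK θ hθ => ?_⟩
  rw [isMDS_baseCode_iff]
  have : Fact p.Prime := ⟨hp⟩
  have : CharP K p := by
    cases nonempty_fintype K
    exact charP_of_card_eq_prime_pow (f := D) (by rw [← Nat.card_eq_fintype_card, hK])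
  let : Algebra (ZMod p) K := ZMod.algebra K p
  refine superregular_pow_of_forall_aeval_ne_zero (p := p) hD fun P hP hdeg h0 => ?_
  have htop : IntermediateField.adjoin (ZMod p) {(θ : K)} = ⊤ := by
    rw [eq_top_iff]
    intro y _
    by_cases hy : y = 0
    · rw [hy]; exact zero_mem _
    · obtain ⟨n, hn⟩ := hθ (Units.mk0 y hy)
      have : y = (θ : K) ^ n := by
        rw [← Units.val_zpow_eq_zpow_val]
        exact (congrArg Units.val hn).symm
      rw [this]
      exact zpow_mem (IntermediateField.mem_adjoin_simple_self _ _) n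
  have hint : IsIntegral (ZMod p) (θ : K) := Algebra.IsIntegral.isIntegral _
  have h1 := IntermediateField.adjoin.finrank hint
  rw [htop, IntermediateField.finrank_top'] at h1
  have h2 : Nat.card K = p ^ Module.finrank (ZMod p) K := by
    rw [Module.natCard_eq_pow_finrank (K := ZMod p), Nat.card_zmod]
  have h3 : Module.finrank (ZMod p) K = D :=
    Nat.pow_right_injective hp.two_le (h2.symm.trans hK)
  have h4 := Polynomial.natDegree_le_of_dvd (minpoly.dvd (ZMod p) (θ : K) h0) hP
  omega

namespace Superregular

variable {K : Type*} [Field K] {ξ : ℕ → K} {k r : ℕ}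

theorem mono (h : Superregular ξ k r) {k' r' : ℕ} (hk : k' ≤ k) (hr : r' ≤ r) :
    Superregular ξ k' r' := fun X T hX hT =>
  h X T (fun x hx => (hX x hx).trans_le hk) fun t ht => (hT t ht).trans_le hr

theorem ne_zero (h : Superregular ξ k r) (hk : 2 ≤ k) {t : ℕ} (ht : t < r) : ξ t ≠ 0 := by
  intro h0
  -- The entry in column `1` is `ξ t` itself; column `0` would say nothing, whence `2 ≤ k`.
  have := h {1} {t} (by simp; omega) (by simpa using ht) (by simp) (fun _ => 1) (by simp [h0]) 1
    (by simp)
  exact one_ne_zero this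

end Superregular

/-! ### Partial parities of a message -/

/-- The entry of a message at subsymbol `ℓ` of symbol `x`, and zero outside of the range. -/
def subsymbol {K : Type*} [Field K] {k α : ℕ} (m : Fin k × Fin α → K) (x ℓ : ℕ) : K :=
  if h : x < k ∧ ℓ < α then m (⟨x, h.1⟩, ⟨ℓ, h.2⟩) else 0

section PartialParity

variable {K : Type*} [Field K] {ξ : ℕ → K} {k α lam kF : ℕ}

theorem subsymbol_val (m : Fin k × Fin α → K) (x : Fin k) (ℓ : Fin α) :
    subsymbol m x ℓ = m (x, ℓ) := by
  simp [subsymbol]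

theorem subsymbol_of_le {m : Fin k × Fin α → K} {x ℓ : ℕ} (h : α ≤ ℓ) : subsymbol m x ℓ = 0 := by
  simp [subsymbol, h.not_gt]

theorem subsymbol_of_symbol_le {m : Fin k × Fin α → K} {x ℓ : ℕ} (h : k ≤ x) :
    subsymbol m x ℓ = 0 := by
  simp [subsymbol, h.not_gt]

theorem eq_zero_of_subsymbol_eq_zero {m : Fin k × Fin α → K} (h : ∀ x ℓ, subsymbol m x ℓ = 0) :
    m = 0 := by
  funext ⟨x, ℓ⟩
  exact (subsymbol_val m x ℓ).symm.trans (h x ℓ)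

theorem dotProduct_partialParity_eq_sum_fin (m : Fin k × Fin α → K) (i t ℓ : ℕ) :
    m ⬝ᵥ partialParity ξ kF i t ℓ =
      ∑ x : Fin k, if (x : ℕ) / kF = i then subsymbol m x ℓ * ξ t ^ (x : ℕ) else 0 := by
  rw [dotProduct, Fintype.sum_prod_type]
  refine Finset.sum_congr rfl fun x _ => ?_
  by_cases hx : (x : ℕ) / kF = i
  · by_cases hℓ : ℓ < α
    · rw [Finset.sum_eq_single ⟨ℓ, hℓ⟩]
      · simp [partialParity, hx, subsymbol, hℓ]
      · intro b _ hb
        have : (b : ℕ) ≠ ℓ := fun h => hb (Fin.ext h)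
        simp [partialParity, this]
      · simp
    · rw [subsymbol_of_le (not_lt.1 hℓ), if_pos hx, zero_mul]
      refine Finset.sum_eq_zero fun b _ => ?_
      have : (b : ℕ) ≠ ℓ := by omega
      simp [partialParity, this]
  · simp [partialParity, hx]

theorem dotProduct_partialParity (m : Fin k × Fin α → K) (i t ℓ : ℕ) :
    m ⬝ᵥ partialParity ξ kF i t ℓ =
      ∑ x ∈ range k, if x / kF = i then subsymbol m x ℓ * ξ t ^ x else 0 := by
  rw [dotProduct_partialParity_eq_sum_fin,
    Finset.sum_range fun x => if x / kF = i then subsymbol m x ℓ * ξ t ^ x else 0]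

theorem dotProduct_partialParity_eq_zero {m : Fin k × Fin α → K} {ℓ : ℕ}
    (h : ∀ x, subsymbol m x ℓ = 0) (i t : ℕ) : m ⬝ᵥ partialParity ξ kF i t ℓ = 0 := by
  rw [dotProduct_partialParity]
  exact Finset.sum_eq_zero fun x _ => by simp [h]

theorem dotProduct_partialParity_zero (m : Fin kF × Fin α → K) (t ℓ : ℕ) :
    m ⬝ᵥ partialParity ξ kF 0 t ℓ = ∑ x ∈ range kF, subsymbol m x ℓ * ξ t ^ x := by
  rw [dotProduct_partialParity]
  exact Finset.sum_congr rfl fun x hx => if_pos (Nat.div_eq_of_lt (by simpa using hx))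

theorem dotProduct_sum_partialParity (m : Fin (lam * kF) × Fin α → K) (t : ℕ) (f : ℕ → ℕ) :
    (m ⬝ᵥ ∑ i : Fin lam, partialParity ξ kF i t (f i)) =
      ∑ x ∈ range (lam * kF), subsymbol m x (f (x / kF)) * ξ t ^ x := by
  simp only [dotProduct_sum, dotProduct_partialParity]
  rw [Finset.sum_comm]
  refine Finset.sum_congr rfl fun x hx => ?_
  have hx : x / kF < lam := Nat.div_lt_of_lt_mul (by rw [mul_comm]; simpa using hx)
  rw [Finset.sum_eq_single ⟨x / kF, hx⟩]
  · simp
  · intro i _ hi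
    exact if_neg fun h => hi (Fin.ext h.symm)
  · simp

/-- If every other part of the message is zero at its instance, only the given part is left. -/
theorem dotProduct_sum_partialParity_eq_single {m : Fin (lam * kF) × Fin α → K} {f : ℕ → ℕ}
    (i : Fin lam) (h : ∀ i' : Fin lam, i' ≠ i → ∀ x, subsymbol m x (f i') = 0) (t : ℕ) :
    (m ⬝ᵥ ∑ i : Fin lam, partialParity ξ kF i t (f i)) = m ⬝ᵥ partialParity ξ kF i t (f i) := by
  rw [dotProduct_sum, Finset.sum_eq_single i]
  · exact fun i' _ hi' => dotProduct_partialParity_eq_zero (h i' hi') _ _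
  · simp

theorem subsymbol_messagePart (m : Fin (lam * kF) × Fin α → K) (i : Fin lam) (j : Fin kF) (ℓ : ℕ) :
    subsymbol (messagePart m i) j ℓ = subsymbol m (finProdFinEquiv (i, j)) ℓ := by
  by_cases hℓ : ℓ < α
  · exact (subsymbol_val (messagePart m i) j ⟨ℓ, hℓ⟩).trans (subsymbol_val m _ ⟨ℓ, hℓ⟩).symm
  · rw [subsymbol_of_le (not_lt.1 hℓ), subsymbol_of_le (not_lt.1 hℓ)]

/-- Symbol `j` of part `i` is message symbol `i * kF + j`; the offset contributes the common factor.
-/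
theorem dotProduct_partialParity_eq_messagePart (m : Fin (lam * kF) × Fin α → K) (i : Fin lam)
    (t ℓ : ℕ) :
    m ⬝ᵥ partialParity ξ kF i t ℓ =
      ξ t ^ (i * kF : ℕ) * (messagePart m i ⬝ᵥ partialParity ξ kF 0 t ℓ) := by
  rw [dotProduct_partialParity_eq_sum_fin, dotProduct_partialParity_zero,
    Finset.sum_range fun x => subsymbol (messagePart m i) x ℓ * ξ t ^ x,
    ← finProdFinEquiv.sum_comp, Fintype.sum_prod_type, Finset.sum_eq_single i]
  · rw [Finset.mul_sum]
    refine Finset.sum_congr rfl fun j _ => ?_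
    rw [subsymbol_messagePart, if_pos, finProdFinEquiv_apply_val, pow_add, mul_comm kF]
    · ring
    · rw [finProdFinEquiv_apply_val, Nat.add_mul_div_left _ _ j.pos, Nat.div_eq_of_lt j.isLt,
        zero_add]
  · intro i' _ hi'
    refine Finset.sum_eq_zero fun j _ => if_neg ?_
    rw [finProdFinEquiv_apply_val, Nat.add_mul_div_left _ _ j.pos, Nat.div_eq_of_lt j.isLt,
      zero_add]
    exact fun h => hi' (Fin.ext h)
  · simp

theorem messagePart_dotProduct_eq_zero {m : Fin (lam * kF) × Fin α → K} {i : Fin lam} {t ℓ : ℕ}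
    (ht : ξ t ≠ 0) (h : m ⬝ᵥ partialParity ξ kF i t ℓ = 0) :
    messagePart m i ⬝ᵥ partialParity ξ kF 0 t ℓ = 0 := by
  rw [dotProduct_partialParity_eq_messagePart] at h
  exact (mul_eq_zero.1 h).resolve_left (pow_ne_zero _ ht)

/-- Decoding one instance of the base code, whose symbol `x` is subsymbol `f x` of symbol `x`. -/
theorem Superregular.subsymbol_eq_zero {r : ℕ} (hξ : Superregular ξ k r) {X : Finset (Fin k)}
    {T : Finset (Fin r)} (hXT : X.card ≤ T.card) {m : Fin k × Fin α → K}
    (hX : ∀ x ∉ X, ∀ ℓ, m (x, ℓ) = 0) (f : ℕ → ℕ)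
    (hT : ∀ t ∈ T, ∑ x ∈ range k, subsymbol m x (f x) * ξ t ^ x = 0) (x : ℕ) :
    subsymbol m x (f x) = 0 := by
  by_cases hx : x ∈ X.map Fin.valEmbedding
  · refine hξ (X.map Fin.valEmbedding) (T.map Fin.valEmbedding) (by simp) (by simp)
      (by rwa [Finset.card_map, Finset.card_map]) (fun x => subsymbol m x (f x)) ?_ x hx
    simp only [Finset.mem_map]
    rintro _ ⟨t, ht, rfl⟩
    refine Eq.trans ?_ (hT t ht)
    rw [Finset.sum_range fun x => subsymbol m x (f x) * ξ t ^ x, Finset.sum_map]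
    refine Finset.sum_subset (Finset.subset_univ _) fun x _ hx => ?_
    simp [subsymbol, hX x hx]
  · unfold subsymbol
    split_ifs with h
    · refine hX _ (fun h' => hx ?_) _
      exact Finset.mem_map_of_mem Fin.valEmbedding h'
    · rfl

end PartialParity

/-! ### Arithmetic of the circular shift -/

section ShiftedInstance

variable {lam rF : ℕ}

theorem block_lt {a c : ℕ} (ha : a < lam) (hc : c < rF) : a * rF + c < lam * rF := by
  have : (a + 1) * rF ≤ lam * rF := Nat.mul_le_mul_right _ ha
  rw [add_mul] at this
  omega

theorem block_div {a c : ℕ} (hc : c < rF) : (a * rF + c) / rF = a := by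
  rw [mul_comm, Nat.mul_add_div (by omega), Nat.div_eq_of_lt hc, add_zero]

theorem block_mod {a c : ℕ} (hc : c < rF) : (a * rF + c) % rF = c := by
  rw [mul_comm, Nat.mul_add_mod, Nat.mod_eq_of_lt hc]

theorem shiftedInstance_lt (hlam : 0 < lam) (hrF : 0 < rF) (ℓ i : ℕ) :
    shiftedInstance lam rF ℓ i < lam * rF :=
  block_lt (Nat.mod_lt _ hlam) (Nat.mod_lt _ hrF)

theorem shiftedInstance_block_self {i c : ℕ} (hc : c < rF) :
    shiftedInstance lam rF (i * rF + c) i = c := by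
  rw [shiftedInstance, block_div hc, block_mod hc, Nat.add_sub_cancel_left, Nat.mod_self, zero_mul,
    zero_add]

/-- In block `i`, the parts other than `i` stand at instances that the conversion reads from the
data symbols. -/
theorem le_shiftedInstance_block {i i' c : ℕ} (hi : i < lam) (hi' : i' < lam) (h : i' ≠ i)
    (hc : c < rF) : rF ≤ shiftedInstance lam rF (i * rF + c) i' := by
  rw [shiftedInstance, block_div hc, block_mod hc]
  have : 1 ≤ (i + lam - i') % lam := by
    rw [Nat.one_le_iff_ne_zero]
    intro h0
    obtain ⟨q, hq⟩ := Nat.dvd_of_mod_eq_zero h0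
    have : 0 < q := Nat.pos_of_ne_zero fun hq0 => by simp [hq0] at hq; omega
    have : q < 2 := by
      by_contra! h2
      have := Nat.mul_le_mul_left lam h2
      omega
    obtain rfl : q = 1 := by omega
    omega
  have := Nat.mul_le_mul_right rF this
  omega

/-- The shift permutes the instances of each part, so decoding all shifted instances recovers
everything. It keeps the residue modulo `rF`, on which the piggybacks for `rI ≤ rF` depend. -/
theorem exists_shiftedInstance_eq {i ℓ : ℕ} (hi : i < lam) (hℓ : ℓ < lam * rF) :
    ∃ ℓ' < lam * rF, ℓ' % rF = ℓ % rF ∧ shiftedInstance lam rF ℓ' i = ℓ := by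
  have hrF : 0 < rF := Nat.pos_of_ne_zero fun h => by simp [h] at hℓ
  have hm : ℓ % rF < rF := Nat.mod_lt _ hrF
  have hb : ℓ / rF < lam := Nat.div_lt_of_lt_mul (by rwa [mul_comm])
  refine ⟨(ℓ / rF + i) % lam * rF + ℓ % rF, block_lt (Nat.mod_lt _ (by omega)) hm, block_mod hm, ?_⟩
  rw [shiftedInstance, block_div hm, block_mod hm]
  have : ((ℓ / rF + i) % lam + lam - i) % lam = ℓ / rF := by
    generalize ℓ / rF = b at hb
    rcases lt_or_ge (b + i) lam with h | h
    · rw [Nat.mod_eq_of_lt h, show b + i + lam - i = b + lam by omega,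
        Nat.add_mod_right, Nat.mod_eq_of_lt hb]
    · rw [Nat.mod_eq_sub_mod h, Nat.mod_eq_of_lt (by omega : b + i - lam < lam),
        show b + i - lam + lam - i = b by omega, Nat.mod_eq_of_lt hb]
  rw [this, mul_comm]
  exact Nat.div_add_mod _ _

theorem card_filter_val_mem_Ico {a b n : ℕ} (hb : b ≤ n) :
    (univ.filter fun ℓ : Fin n => a ≤ (ℓ : ℕ) ∧ (ℓ : ℕ) < b).card = b - a := by
  rw [← Nat.card_Ico, ← Finset.card_map Fin.valEmbedding]
  congr 1
  ext x
  simp only [Finset.mem_map, Finset.mem_filter, Finset.mem_univ, true_and, Fin.valEmbedding_apply,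
    Finset.mem_Ico]
  exact ⟨fun ⟨y, hy, hyx⟩ => hyx ▸ hy, fun hx => ⟨⟨x, hx.2.trans_le hb⟩, hx, rfl⟩⟩

end ShiftedInstance

/-! ### The construction for `rF < rI` -/

section DownConstruction

variable {K : Type*} [Field K] {ξ : ℕ → K} {lam kF rI rF : ℕ}

theorem lam_mul_le_downAlpha (hlam : 1 ≤ lam) (hr : rF ≤ rI) : lam * rF ≤ downAlpha lam rI rF := by
  obtain ⟨l, rfl⟩ := Nat.exists_eq_add_of_le' hlam
  rw [downAlpha, Nat.add_sub_cancel, add_mul]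
  omega

/-- Instances from `lam * rF` on have no piggybacks and are decoded first. All piggybacks come from
these, since `(lam - 1) * rF + t ≥ lam * rF` when `t ≥ rF`. -/
theorem isMDS_downInitial (hξ : Superregular ξ (lam * kF) rI) (hlam : 1 ≤ lam)
    (hr : rF ≤ rI) : (downInitial ξ lam kF rI rF).IsMDS := by
  have hα := lam_mul_le_downAlpha hlam hr
  unfold downInitial
  rw [VectorCode.isMDS_systematic_iff]
  intro X T hXT m hX hT
  have hhigh : ∀ ℓ, lam * rF ≤ ℓ → ∀ x, subsymbol m x ℓ = 0 := by
    intro ℓ hℓ x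
    rcases lt_or_ge ℓ (downAlpha lam rI rF) with hlt | hge
    · refine hξ.subsymbol_eq_zero hXT hX (fun _ => ℓ) (fun t ht => ?_) x
      have := hT t ht ⟨ℓ, hlt⟩
      rw [if_neg hℓ.not_gt] at this
      rw [← this]
      exact (dotProduct_sum_partialParity m t fun _ => ℓ).symm
    · exact subsymbol_of_le hge
  refine eq_zero_of_subsymbol_eq_zero fun x ℓ => ?_
  rcases lt_or_ge ℓ (lam * rF) with hℓ | hℓ
  · rcases lt_or_ge x (lam * kF) with hx | hx
    · obtain ⟨ℓ', hℓ', -, rfl⟩ := exists_shiftedInstance_eq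
        (Nat.div_lt_of_lt_mul (by rwa [mul_comm]) : x / kF < lam) hℓ
      refine hξ.subsymbol_eq_zero hXT hX (fun x => shiftedInstance lam rF ℓ' (x / kF))
        (fun t ht => ?_) x
      have := hT t ht ⟨ℓ', hℓ'.trans_le hα⟩
      rw [if_pos hℓ', dotProduct_add, dotProduct_sum_partialParity] at this
      rw [← this, left_eq_add]
      split_ifs with htr
      · exact dotProduct_zero _
      · rw [dotProduct_smul, dotProduct_partialParity_eq_zero, smul_zero]
        refine hhigh _ ?_
        obtain ⟨l, rfl⟩ := Nat.exists_eq_add_of_le' hlam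
        rw [Nat.add_sub_cancel, add_mul]
        omega
    · exact subsymbol_of_symbol_le hx
  · exact hhigh ℓ hℓ x

/-- The order is opposite to that of the initial code: here the instances below `lam * rF` are
clean, and the piggybacks come from instances `t < rF` among them. -/
theorem isMDS_downFinal (hξ : Superregular ξ (lam * kF) rI) (hlam : 1 ≤ lam) (hr : rF ≤ rI) :
    (downFinal ξ lam kF rI rF).IsMDS := by
  have hα := lam_mul_le_downAlpha hlam hr
  have hξ' : Superregular ξ kF rF := hξ.mono (Nat.le_mul_of_pos_left _ hlam) hr
  unfold downFinal
  rw [VectorCode.isMDS_systematic_iff]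
  intro X T hXT m hX hT
  have hlow : ∀ ℓ, ℓ < lam * rF → ∀ x, subsymbol m x ℓ = 0 := by
    intro ℓ hℓ x
    refine hξ'.subsymbol_eq_zero hXT hX (fun _ => ℓ) (fun t ht => ?_) x
    have := hT t ht ⟨ℓ, hℓ.trans_le hα⟩
    rwa [if_pos hℓ, dotProduct_partialParity_zero] at this
  refine eq_zero_of_subsymbol_eq_zero fun x ℓ => ?_
  rcases lt_or_ge ℓ (lam * rF) with hℓ | hℓ
  · exact hlow ℓ hℓ x
  rcases lt_or_ge ℓ (downAlpha lam rI rF) with hlt | hge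
  · refine hξ'.subsymbol_eq_zero hXT hX (fun _ => ℓ) (fun t ht => ?_) x
    have := hT t ht ⟨ℓ, hlt⟩
    rwa [if_neg hℓ.not_gt, dotProduct_add, dotProduct_partialParity_zero,
      dotProduct_partialParity_eq_zero (hlow t (t.isLt.trans_le (Nat.le_mul_of_pos_left _ hlam))),
      add_zero] at this
  · exact subsymbol_of_le hge

theorem exists_down_stableSplitCode (hξ : ∀ t < rI, ξ t ≠ 0) (hlam : 1 ≤ lam) (hr : rF ≤ rI) :
    ∃ C : StableSplitCode K lam kF rI rF (downAlpha lam rI rF),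
      C.initialCode = downInitial ξ lam kF rI rF ∧
      C.finalCode = downFinal ξ lam kF rI rF ∧
      C.KeepsDataSymbols ∧
      (∀ s, ¬ C.IsRetired s → C.amount s = (lam - 1) * rF ∧
        C.Reads s {ℓ | rF ≤ (ℓ : ℕ) ∧ (ℓ : ℕ) < lam * rF}) ∧
      (∀ s, C.IsRetired s → C.amount s = lam * rF ∧ C.Reads s {ℓ | (ℓ : ℕ) < lam * rF}) ∧
      C.readBandwidth = lam * kF * ((lam - 1) * rF) + rI * (lam * rF) := by
  have hα := lam_mul_le_downAlpha hlam hr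
  have hA := card_filter_val_mem_Ico (a := rF) hα
  have hB := card_filter_val_mem_Ico (a := 0) hα
  rw [show lam * rF - rF = (lam - 1) * rF by rw [Nat.sub_mul, one_mul]] at hA
  simp only [Nat.zero_le, true_and, Nat.sub_zero] at hB
  obtain ⟨C, h₁, h₂, h₃, h₄, h₅, h₆⟩ := StableSplitCode.exists_of_reads (K := K) (lam := lam)
    (kF := kF) (rI := rI) (rF := rF) (α := downAlpha lam rI rF)
    (fun t ℓ =>
      if (ℓ : ℕ) < lam * rF then
        (∑ i : Fin lam, partialParity ξ kF i t (shiftedInstance lam rF ℓ i)) +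
          if (t : ℕ) < rF then 0
          else (ξ t / ξ (ℓ % rF)) ^ ((ℓ : ℕ) / rF * kF) •
            partialParity ξ kF (ℓ / rF) (ℓ % rF) ((lam - 1) * rF + t)
      else ∑ i : Fin lam, partialParity ξ kF i t ℓ)
    (fun t ℓ =>
      if (ℓ : ℕ) < lam * rF then partialParity ξ kF 0 t ℓ
      else partialParity ξ kF 0 t ℓ + partialParity ξ kF 0 (rF + (ℓ - lam * rF)) t)
    (univ.filter fun ℓ => rF ≤ (ℓ : ℕ) ∧ (ℓ : ℕ) < lam * rF)
    (univ.filter fun ℓ => (ℓ : ℕ) < lam * rF) fun m hmA hmB i t ℓ => by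
    have hdata : ∀ ℓ, rF ≤ ℓ → ℓ < lam * rF → ∀ x, subsymbol m x ℓ = 0 := by
      intro ℓ h1 h2 x
      unfold subsymbol
      split_ifs with h
      exacts [hmA _ _ (by simp [h1, h2]), rfl]
    -- the parities of instance `c < rF` of part `i`, read from instance `c` of block `i`
    have hblock : ∀ (t : Fin rI) (c : ℕ), c < rF →
        m ⬝ᵥ partialParity ξ kF i t c + (if (t : ℕ) < rF then 0 else
          (ξ t / ξ c) ^ ((i : ℕ) * kF) * m ⬝ᵥ partialParity ξ kF i c ((lam - 1) * rF + t)) = 0 := by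
      intro t c hc
      have hlt := block_lt i.isLt hc
      have h := hmB t ⟨i * rF + c, hlt.trans_le hα⟩ (by simpa using hlt)
      rw [if_pos hlt] at h
      simp only [block_div hc, block_mod hc] at h
      rw [dotProduct_add, dotProduct_sum_partialParity_eq_single
        (f := fun i' => shiftedInstance lam rF (i * rF + c) i') i, shiftedInstance_block_self hc] at h
      · split_ifs at h ⊢ with htr
        · rwa [dotProduct_zero] at h
        · rwa [dotProduct_smul, smul_eq_mul] at h
      · intro i' hi'
        exact hdata _ (le_shiftedInstance_block i.isLt i'.isLt (fun h => hi' (Fin.ext h)) hc)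
          (shiftedInstance_lt hlam (by omega) _ _)
    have ht : ξ t ≠ 0 := hξ t (t.isLt.trans_le hr)
    split_ifs with hℓ
    · refine messagePart_dotProduct_eq_zero ht ?_
      rcases lt_or_ge (ℓ : ℕ) rF with h | h
      -- Retired parities below `rF` have no piggyback here and directly give the final parities.
      · simpa using hblock (Fin.castLE hr t) ℓ h
      · exact dotProduct_partialParity_eq_zero (hdata ℓ h hℓ) _ _
    · have hu : rF + (ℓ - lam * rF) < rI := by
        have h1 := ℓ.isLt
        have h2 : (lam - 1) * rF + rF = lam * rF := by
          rw [← Nat.succ_mul, Nat.succ_eq_add_one, Nat.sub_add_cancel hlam]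
        unfold downAlpha at h1
        omega
      -- With `u = rF + (ℓ - lam * rF)`, retired parity `u` carries, for instance `t` of part `i`,
      -- the piggyback of parity `t` of instance `ℓ`: the two terms of the final subsymbol.
      have hinst : (lam - 1) * rF + (rF + (ℓ - lam * rF)) = ℓ := by
        have h2 : (lam - 1) * rF + rF = lam * rF := by
          rw [← Nat.succ_mul, Nat.succ_eq_add_one, Nat.sub_add_cancel hlam]
        omega
      have h := hblock ⟨rF + (ℓ - lam * rF), hu⟩ t t.isLt
      rw [if_neg (by simp)] at h
      simp only [hinst] at h
      -- The scalar in the piggyback replaces its offset factor by that of parity `u`, so the factor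
      -- common to both terms can be cancelled.
      rw [dotProduct_partialParity_eq_messagePart, dotProduct_partialParity_eq_messagePart,
        ← mul_assoc, ← mul_pow, div_mul_cancel₀ _ ht, ← mul_add] at h
      rw [dotProduct_add, add_comm]
      exact (mul_eq_zero.1 h).resolve_left (pow_ne_zero _ (hξ _ hu))
  rw [hA, hB] at h₆
  simp only [hA, hB, Finset.coe_filter, Finset.mem_univ, true_and] at h₄ h₅
  exact ⟨C, h₁, h₂, h₃, h₄, h₅, h₆⟩

end DownConstruction

/-! ### The construction for `rI ≤ rF` -/

section UpConstruction

variable {K : Type*} [Field K] {ξ : ℕ → K} {lam kF rI rF : ℕ}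

theorem isMDS_upInitial (hξ : Superregular ξ (lam * kF) rI) (hlam : 1 ≤ lam) (hr : rI ≤ rF) :
    (upInitial ξ lam kF rI rF).IsMDS := by
  unfold upInitial
  rw [VectorCode.isMDS_systematic_iff]
  intro X T hXT m hX hT
  -- Decoding proceeds by residue classes modulo `rF`: a class is decoded once its piggybacks
  -- vanish. Classes below `rI` have none.
  have hstep : ∀ c, (∀ ℓ : Fin (upAlpha lam rF), (ℓ : ℕ) % rF = c → ∀ t ∈ T,
      (m ⬝ᵥ if (ℓ : ℕ) % rF < rI then 0
        else partialParity ξ kF (ℓ / rF) (ℓ % rF) t) = 0) →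
      ∀ ℓ, ℓ < lam * rF → ℓ % rF = c → ∀ x, subsymbol m x ℓ = 0 := by
    intro c hc ℓ hℓ hℓc x
    rcases lt_or_ge x (lam * kF) with hx | hx
    · obtain ⟨ℓ', hℓ', hmod, rfl⟩ := exists_shiftedInstance_eq
        (Nat.div_lt_of_lt_mul (by rwa [mul_comm]) : x / kF < lam) hℓ
      refine hξ.subsymbol_eq_zero hXT hX (fun x => shiftedInstance lam rF ℓ' (x / kF))
        (fun t ht => ?_) x
      have := hT t ht ⟨ℓ', hℓ'⟩
      rwa [dotProduct_add, dotProduct_sum_partialParity, hc ⟨ℓ', hℓ'⟩ (hmod.trans hℓc) t ht,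
        add_zero] at this
    · exact subsymbol_of_symbol_le hx
  have hlow : ∀ ℓ, ℓ < lam * rF → ℓ % rF < rI → ∀ x, subsymbol m x ℓ = 0 := by
    intro ℓ hℓ hlt
    refine hstep _ (fun ℓ' hℓ' t ht => ?_) ℓ hℓ rfl
    rw [if_pos (by rwa [hℓ']), dotProduct_zero]
  refine eq_zero_of_subsymbol_eq_zero fun x ℓ => ?_
  rcases lt_or_ge ℓ (lam * rF) with hℓ | hℓ
  · refine hstep _ (fun ℓ' _ t ht => ?_) ℓ hℓ rfl x
    split_ifs
    · exact dotProduct_zero _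
    -- The piggyback comes from instance `t < rI`, which is its own residue and so already decoded.
    · have htF : (t : ℕ) < rF := t.isLt.trans_le hr
      refine dotProduct_partialParity_eq_zero (hlow t ?_ ?_) _ _
      · exact htF.trans_le (Nat.le_mul_of_pos_left _ hlam)
      · rw [Nat.mod_eq_of_lt htF]
        exact t.isLt
  · exact subsymbol_of_le hℓ

theorem isMDS_upFinal (hξ : Superregular ξ kF rF) : (upFinal ξ lam kF rF).IsMDS := by
  unfold upFinal
  rw [VectorCode.isMDS_systematic_iff]
  intro X T hXT m hX hT
  refine eq_zero_of_subsymbol_eq_zero fun x ℓ => ?_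
  rcases lt_or_ge ℓ (lam * rF) with hℓ | hℓ
  · refine hξ.subsymbol_eq_zero hXT hX (fun _ => ℓ) (fun t ht => ?_) x
    have := hT t ht ⟨ℓ, hℓ⟩
    rwa [dotProduct_partialParity_zero] at this
  · exact subsymbol_of_le hℓ

theorem exists_up_stableSplitCode (hξ : ∀ t < rF, ξ t ≠ 0) (hr : rI ≤ rF) :
    ∃ C : StableSplitCode K lam kF rI rF (upAlpha lam rF),
      C.initialCode = upInitial ξ lam kF rI rF ∧
      C.finalCode = upFinal ξ lam kF rF ∧
      C.KeepsDataSymbols ∧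
      (∀ s, ¬ C.IsRetired s → C.amount s = lam * rF - rI ∧ C.Reads s {ℓ | rI ≤ (ℓ : ℕ)}) ∧
      (∀ s, C.IsRetired s → C.amount s = lam * rF ∧ C.Reads s Set.univ) ∧
      C.readBandwidth = lam * kF * (lam * rF - rI) + rI * (lam * rF) := by
  have hA : (univ.filter fun ℓ : Fin (upAlpha lam rF) => rI ≤ (ℓ : ℕ)).card = lam * rF - rI := by
    have := card_filter_val_mem_Ico (a := rI) (le_refl (upAlpha lam rF))
    simp only [Fin.is_lt, and_true] at this
    exact this
  obtain ⟨C, h₁, h₂, h₃, h₄, h₅, h₆⟩ := StableSplitCode.exists_of_reads (K := K) (lam := lam)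
    (kF := kF) (rI := rI) (rF := rF) (α := upAlpha lam rF)
    (fun t ℓ =>
      (∑ i : Fin lam, partialParity ξ kF i t (shiftedInstance lam rF ℓ i)) +
        if (ℓ : ℕ) % rF < rI then 0
        else partialParity ξ kF (ℓ / rF) (ℓ % rF) t)
    (fun t ℓ => partialParity ξ kF 0 t ℓ)
    (univ.filter fun ℓ => rI ≤ (ℓ : ℕ)) univ fun m hmA hmB i t ℓ => by
    have hdata : ∀ ℓ, rI ≤ ℓ → ∀ x, subsymbol m x ℓ = 0 := by
      intro ℓ h1 x
      unfold subsymbol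
      split_ifs with h
      exacts [hmA _ _ (by simp [h1]), rfl]
    have hblock : ∀ (t : Fin rI) (c : ℕ), c < rF →
        m ⬝ᵥ partialParity ξ kF i t c + (if c < rI then 0 else
          m ⬝ᵥ partialParity ξ kF i c t) = 0 := by
      intro t c hc
      have h := hmB t ⟨i * rF + c, block_lt i.isLt hc⟩ (Finset.mem_univ _)
      simp only [block_div hc, block_mod hc] at h
      rw [dotProduct_add, dotProduct_sum_partialParity_eq_single
        (f := fun i' => shiftedInstance lam rF (i * rF + c) i') i, shiftedInstance_block_self hc] at h
      · split_ifs at h ⊢ with htr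
        · rwa [dotProduct_zero] at h
        · exact h
      · intro i' hi'
        exact hdata _ (hr.trans
          (le_shiftedInstance_block i.isLt i'.isLt (fun h => hi' (Fin.ext h)) hc))
    refine messagePart_dotProduct_eq_zero (hξ t t.isLt) ?_
    rcases lt_or_ge (ℓ : ℕ) rI with hℓ | hℓ
    · rcases lt_or_ge (t : ℕ) rI with ht | ht
      · simpa [hℓ] using hblock ⟨t, ht⟩ ℓ (hℓ.trans_le hr)
      -- The roles of parity and instance are exchanged: parity `t ≥ rI` of instance `ℓ < rI` is the
      -- piggyback on retired parity `ℓ` at instance `t`, whose own data are read.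
      · have := hblock ⟨ℓ, hℓ⟩ t t.isLt
        rwa [if_neg ht.not_gt, dotProduct_partialParity_eq_zero (hdata t ht), zero_add] at this
    · exact dotProduct_partialParity_eq_zero (hdata ℓ hℓ) _ _
  have hB : (univ : Finset (Fin (upAlpha lam rF))).card = lam * rF := by
    rw [Finset.card_univ, Fintype.card_fin, upAlpha]
  rw [hA, hB] at h₆
  simp only [hA, hB, Finset.coe_filter, Finset.coe_univ, Finset.mem_univ, true_and] at h₄ h₅
  exact ⟨C, h₁, h₂, h₃, h₄, h₅, h₆⟩

end UpConstruction

/-! ### Lower bounds on the read bandwidth -/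

namespace StableSplitCode

variable {K : Type*} [Field K] {lam kF rI rF α : ℕ} (C : StableSplitCode K lam kF rI rF α)

open Classical in
theorem sum_eq_sum_unchanged_add_sum_retired (f : Fin (lam * kF + rI) → ℕ) :
    ∑ s, f s = (∑ i, ∑ j, f (C.unchanged i j)) + ∑ s with C.IsRetired s, f s := by
  rw [← Finset.sum_filter_not_add_sum_filter univ C.IsRetired f]
  congr 1
  have : (univ.filter fun s => ¬ C.IsRetired s) =
      univ.map ⟨Function.uncurry C.unchanged, C.unchanged_injective⟩ := by
    ext s
    simp [IsRetired]
  rw [this, Finset.sum_map, Fintype.sum_prod_type]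
  rfl

theorem readBandwidth_eq : C.readBandwidth = C.readUnchanged + C.readRetired :=
  C.sum_eq_sum_unchanged_add_sum_retired C.amount

open Classical in
theorem card_retired : (univ.filter fun s => C.IsRetired s).card = rI := by
  have := C.sum_eq_sum_unchanged_add_sum_retired fun _ => 1
  simp only [Finset.sum_const, Finset.card_univ, Fintype.card_fin, smul_eq_mul, mul_one] at this
  omega

/-- The amount of information downloaded from an initial symbol. -/
def effectiveAmount (s : Fin (lam * kF + rI)) : ℕ := min (C.amount s) α

/-- However many elements are downloaded, a function of `α` subsymbols takes at most as many values
as there are contents. -/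
theorem card_range_download_le [Finite K] (s : Fin (lam * kF + rI)) :
    Nat.card (Set.range (C.download s)) ≤ Nat.card K ^ C.effectiveAmount s := by
  have hK : 0 < Nat.card K := Nat.card_pos
  unfold effectiveAmount
  rcases min_choice (C.amount s) α with h | h <;> rw [h]
  · refine (Nat.card_mono Set.finite_univ (Set.subset_univ _)).trans_eq ?_
    simp [Nat.card_fun]
  · refine (Finite.card_range_le _).trans_eq ?_
    simp [Nat.card_fun]

/-- The contents of the unchanged symbols can be prescribed. -/
theorem exists_message [Finite K] (hC : C.finalCode.IsMDS) (y : Fin lam → Fin kF → Fin α → K) :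
    ∃ m, ∀ i j, C.initialCode.encode m (C.unchanged i j) = y i j := by
  have hpart : ∀ i, ∃ m₀, ∀ j, C.finalCode.encode m₀ (C.place i j) = y i j := by
    intro i
    let L : (Fin kF × Fin α → K) → (Fin kF → Fin α → K) :=
      fun m j => C.finalCode.encode m (C.place i j)
    have hinj : Function.Injective L := by
      intro m m' h
      refine hC (univ.map ⟨C.place i, C.place_injective i⟩) (by simp) m m' ?_
      simp only [Finset.mem_map]
      rintro _ ⟨j, -, rfl⟩
      exact congrFun h j
    -- Messages and contents of `kF` symbols form finite sets of equal size, so injectivity gives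
    -- surjectivity.
    obtain ⟨m₀, hm₀⟩ :=
      (Finite.injective_iff_surjective_of_equiv (Equiv.curry _ _ _)).1 hinj (y i)
    exact ⟨m₀, congrFun hm₀⟩
  choose m₀ hm₀ using hpart
  refine ⟨fun x => m₀ (finProdFinEquiv.symm x.1).1 ((finProdFinEquiv.symm x.1).2, x.2), ?_⟩
  intro i j
  rw [← C.unchanged_correct, ← hm₀]
  congr 1
  funext x
  simp [messagePart]

/-- The new symbols, and the unchanged symbols outside of `Set.range e`, determine the message. -/
theorem messagePart_eq (hC : C.finalCode.IsMDS) {e : Fin rF → Fin kF} (he : Function.Injective e)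
    {m m' : Fin (lam * kF) × Fin α → K}
    (hd : ∀ s, C.download s (C.initialCode.encode m s) =
      C.download s (C.initialCode.encode m' s)) (i : Fin lam)
    (hu : ∀ j ∉ Set.range e, C.initialCode.encode m (C.unchanged i j) =
      C.initialCode.encode m' (C.unchanged i j)) :
    messagePart m i = messagePart m' i := by
  classical
  have hinj : Function.Injective fun d => C.place i (e d) := (C.place_injective i).comp he
  refine hC (univ.map ⟨_, hinj⟩)ᶜ ?_ _ _ fun s hs => ?_
  · rw [Finset.card_compl, Finset.card_map]
    simp
  · by_cases hp : s ∈ Set.range (C.place i)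
    · obtain ⟨j, rfl⟩ := hp
      rw [C.unchanged_correct, C.unchanged_correct]
      refine hu j ?_
      rintro ⟨d, rfl⟩
      simp at hs
    · rw [← C.new_correct m i s hp, ← C.new_correct m' i s hp]
      congr 2
      exact funext hd

variable [Finite K]

open Classical in
/-- What is downloaded from `rF` unchanged symbols of each final codeword and from the retired
symbols is at least the content of the new symbols. -/
theorem new_le_sum_effectiveAmount (hC : C.finalCode.IsMDS) {e : Fin rF → Fin kF}
    (he : Function.Injective e) :
    lam * rF * α ≤ (∑ i, ∑ d, C.effectiveAmount (C.unchanged i (e d))) +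
      ∑ s with C.IsRetired s, C.effectiveAmount s := by
  have hK : 1 < Nat.card K := Finite.one_lt_card
  have hM : ∀ y : Fin lam → Fin rF → Fin α → K, ∃ m,
      (∀ i d, C.initialCode.encode m (C.unchanged i (e d)) = y i d) ∧
      ∀ i, ∀ j ∉ Set.range e, C.initialCode.encode m (C.unchanged i j) = 0 := by
    intro y
    obtain ⟨m, hm⟩ := C.exists_message hC fun i => Function.extend e (y i) 0
    refine ⟨m, fun i d => ?_, fun i j hj => ?_⟩
    · rw [hm, he.extend_apply]
    · rw [hm, Function.extend_apply' _ _ _ hj]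
      rfl
  choose M hM₁ hM₂ using hM
  let σ : (Fin lam × Fin rF) ⊕ {s // C.IsRetired s} → Fin (lam * kF + rI) :=
    Sum.elim (fun p => C.unchanged p.1 (e p.2)) Subtype.val
  -- Downloads from the free and the retired symbols. The other unchanged symbols are fixed at zero
  -- and their downloads are constant, so `F` is injective; comparing cardinalities gives the bound.
  let F : (Fin lam → Fin rF → Fin α → K) → ∀ a, Set.range (C.download (σ a)) :=
    fun y a => ⟨_, Set.mem_range_self (C.initialCode.encode (M y) (σ a))⟩
  have hF : Function.Injective F := by
    intro y y' h
    have hd : ∀ s, C.download s (C.initialCode.encode (M y) s) =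
        C.download s (C.initialCode.encode (M y') s) := by
      intro s
      by_cases hs : C.IsRetired s
      · exact congrArg Subtype.val (congrFun h (Sum.inr ⟨s, hs⟩))
      · simp only [IsRetired, not_forall, not_not] at hs
        obtain ⟨i, j, rfl⟩ := hs
        by_cases hj : j ∈ Set.range e
        · obtain ⟨d, rfl⟩ := hj
          exact congrArg Subtype.val (congrFun h (Sum.inl (i, d)))
        · rw [hM₂ _ _ _ hj, hM₂ _ _ _ hj]
    funext i d
    have := C.messagePart_eq hC he hd i fun j hj => by rw [hM₂ _ _ _ hj, hM₂ _ _ _ hj]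
    rw [← hM₁ y, ← hM₁ y', ← C.unchanged_correct, ← C.unchanged_correct, this]
  have hcard := Nat.card_le_card_of_injective F hF
  have := (hcard.trans_eq Nat.card_pi).trans
    (Finset.prod_le_prod' (s := univ) fun a _ => C.card_range_download_le (σ a))
  rw [Finset.prod_pow_eq_pow_sum] at this
  simp only [Nat.card_fun, Nat.card_fin, ← pow_mul] at this
  rw [Nat.pow_le_pow_iff_right hK, Fintype.sum_sum_type, Fintype.sum_prod_type] at this
  rw [Finset.sum_subtype (p := C.IsRetired) (univ.filter C.IsRetired) (by simp)]
  calc lam * rF * α = α * rF * lam := by ring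
    _ ≤ _ := this

open Classical in
theorem mul_new_le_sum_effectiveAmount (hC : C.finalCode.IsMDS) (hrF : 1 ≤ rF) (hk : rF ≤ kF) :
    kF * (lam * rF * α) ≤ rF * (∑ i, ∑ j, C.effectiveAmount (C.unchanged i j)) +
      kF * ∑ s with C.IsRetired s, C.effectiveAmount s := by
  have : NeZero kF := ⟨by omega⟩
  -- Of the `kF` cyclic windows of length `rF`, exactly `rF` contain a given position.
  have h : ∀ c : Fin kF, _ := fun c => C.new_le_sum_effectiveAmount hC
    (e := fun d => Fin.castLE hk d + c)
    fun d d' hd => Fin.castLE_injective hk (add_right_cancel hd)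
  have hsum := Finset.sum_le_sum fun c (_ : c ∈ univ) => h c
  rw [Finset.sum_add_distrib] at hsum
  simp only [Finset.sum_const, Finset.card_univ, Fintype.card_fin, smul_eq_mul] at hsum
  refine hsum.trans_eq ?_
  congr 1
  rw [Finset.sum_comm, Finset.mul_sum]
  refine Finset.sum_congr rfl fun i _ => ?_
  rw [Finset.sum_comm]
  have : ∀ d : Fin rF, ∑ c, C.effectiveAmount (C.unchanged i (Fin.castLE hk d + c)) =
      ∑ j, C.effectiveAmount (C.unchanged i j) := fun d =>
    Equiv.sum_comp (Equiv.addLeft (Fin.castLE hk d)) fun j => C.effectiveAmount (C.unchanged i j)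
  simp [this]

/-- As `rF ≤ kF`, the averaged inequality bounds the total from below by a nonincreasing function of
the retired amount. That amount is at most `rI * α`, because effective amounts are capped at `α`. -/
theorem looseBound_le (hC : C.finalCode.IsMDS) (hrF : 1 ≤ rF) (hk : rF ≤ kF)
    (hrI : rI ≤ lam * rF) : looseBound lam kF rI rF α ≤ (C.readBandwidth : ℚ) := by
  classical
  have h := C.mul_new_le_sum_effectiveAmount hC hrF hk
  have hR : ∑ s with C.IsRetired s, C.effectiveAmount s ≤ rI * α := by
    refine (Finset.sum_le_card_nsmul _ _ α fun s _ => min_le_right _ _).trans_eq ?_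
    rw [C.card_retired, smul_eq_mul]
  have hB : (∑ i, ∑ j, C.effectiveAmount (C.unchanged i j)) +
      ∑ s with C.IsRetired s, C.effectiveAmount s ≤ C.readBandwidth := by
    rw [← C.sum_eq_sum_unchanged_add_sum_retired]
    exact Finset.sum_le_sum fun s _ => min_le_left _ _
  generalize ∑ i, ∑ j, C.effectiveAmount (C.unchanged i j) = U at h hB
  generalize ∑ s with C.IsRetired s, C.effectiveAmount s = R at h hB hR
  generalize C.readBandwidth = γ at hB
  qify at h hR hB hrF hk
  have hpos : (0 : ℚ) < rF := by linarith
  rw [looseBound, if_pos hrI, max_eq_left (by rw [sub_nonneg, le_div_iff₀ hpos]; linarith)]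
  refine le_trans ?_ hB
  rw [← mul_le_mul_iff_right₀ hpos]
  have : (rF : ℚ) * (lam * kF * α - rI * α * (kF / rF - 1)) =
      kF * (lam * rF * α) - (kF - rF) * (rI * α) := by
    field_simp
  rw [this]
  nlinarith [mul_le_mul_of_nonneg_left hR (sub_nonneg.2 hk)]

theorem tightBound_le (hC : C.finalCode.IsMDS) (hlam : 1 ≤ lam) (hrF : 1 ≤ rF) (hk : rF ≤ kF)
    (hrI : 0 < rI) (hconj : C.ConjecturedInequality) :
    tightBound lam kF rI rF α ≤ (C.readBandwidth : ℚ) := by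
  classical
  have h : kF * (lam * rF * α) ≤ rF * C.readUnchanged + kF * C.readRetired := by
    refine (C.mul_new_le_sum_effectiveAmount hC hrF hk).trans ?_
    refine add_le_add (Nat.mul_le_mul_left _ ?_) (Nat.mul_le_mul_left _ ?_)
    · exact Finset.sum_le_sum fun i _ => Finset.sum_le_sum fun j _ => min_le_left _ _
    · exact Finset.sum_le_sum fun s _ => min_le_left _ _
  rw [C.readBandwidth_eq]
  unfold ConjecturedInequality at hconj
  generalize C.readUnchanged = U at h hconj
  generalize C.readRetired = R at h hconj
  qify at h hrF hk hrI hlam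
  have hkpos : (0 : ℚ) < kF := by linarith
  have hlpos : (0 : ℚ) < lam := by linarith
  have hconj' : ((lam : ℚ) - 1) * kF * R ≤ rI * U := by
    have h1 : (lam : ℚ) * (U / (lam * kF : ℕ)) = U / kF := by
      push_cast
      field_simp
    rw [h1, ← mul_div_assoc, div_le_div_iff₀ hrI hkpos] at hconj
    linarith
  have hD : (0 : ℚ) < (lam - 1) * rF + rI := by nlinarith
  have hN : (0 : ℚ) ≤ (lam - 1) * kF + rI := by nlinarith
  rw [tightBound, ← mul_div_assoc, div_le_iff₀ hD, ← mul_le_mul_iff_right₀ hkpos]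
  push_cast
  -- With weights `(lam - 1) * kF + rI` and `kF - rF`, both `U` and `R` receive the coefficient `kF
  -- * ((lam - 1) * rF + rI)`.
  nlinarith [mul_le_mul_of_nonneg_left h hN,
    mul_le_mul_of_nonneg_left hconj' (sub_nonneg.2 hk)]

end StableSplitCode

/-! ### Comparison per subsymbol and the main theorem -/

namespace StableSplitCode

/-- The bound and the write cost are both linear in the number of subsymbols, so codes with
different `α` can be compared. -/
theorem bandwidth_div_le {K K' : Type*} [Field K] [Field K'] {lam kF rI rF α α' : ℕ}
    (C : StableSplitCode K lam kF rI rF α) (C' : StableSplitCode K' lam kF rI rF α')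
    (hα : 0 < α) (hα' : 0 < α') {c : ℚ} (h : (C.readBandwidth : ℚ) = c * α)
    (h' : c * α' ≤ C'.readBandwidth) : (C.bandwidth : ℚ) / α ≤ (C'.bandwidth : ℚ) / α' := by
  have hα : (0 : ℚ) < α := by exact_mod_cast hα
  have hα' : (0 : ℚ) < α' := by exact_mod_cast hα'
  simp only [bandwidth]
  push_cast
  rw [h, ← add_mul, mul_div_cancel_right₀ _ hα.ne', le_div_iff₀ hα']
  linarith

end StableSplitCode

theorem tightBound_eq_mul (lam kF rI rF α : ℕ) :
    tightBound lam kF rI rF α = tightBound lam kF rI rF 1 * α := by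
  simp only [tightBound]
  push_cast
  ring

theorem looseBound_eq_mul (lam kF rI rF α : ℕ) :
    looseBound lam kF rI rF α = looseBound lam kF rI rF 1 * α := by
  simp only [looseBound]
  split_ifs
  · push_cast
    ring
  · push_cast
    ring

theorem tightBound_downAlpha {lam kF rI rF : ℕ} (hlam : 1 ≤ lam) (hr : 0 < rI) :
    tightBound lam kF rI rF (downAlpha lam rI rF) =
      (lam * kF * ((lam - 1) * rF) + rI * (lam * rF) : ℕ) := by
  obtain ⟨l, rfl⟩ := Nat.exists_eq_add_of_le' hlam
  have : (0 : ℚ) < rI := by exact_mod_cast hr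
  simp only [tightBound, downAlpha, Nat.add_sub_cancel]
  push_cast
  rw [add_sub_cancel_right]
  have : (l : ℚ) * rF + rI ≠ 0 := by positivity
  field_simp

theorem looseBound_upAlpha {lam kF rI rF : ℕ} (hlam : 1 ≤ lam) (hrF : 1 ≤ rF) (hk : rF ≤ kF)
    (hr : rI ≤ rF) :
    looseBound lam kF rI rF (upAlpha lam rF) =
      (lam * kF * (lam * rF - rI) + rI * (lam * rF) : ℕ) := by
  have hle : rI ≤ lam * rF := hr.trans (Nat.le_mul_of_pos_left _ hlam)
  have hpos : (0 : ℚ) < rF := by exact_mod_cast hrF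
  have hkq : (rF : ℚ) ≤ kF := by exact_mod_cast hk
  rw [looseBound, if_pos hle, max_eq_left (by rw [sub_nonneg, le_div_iff₀ hpos]; linarith), upAlpha]
  push_cast [Nat.cast_sub hle]
  field_simp
  ring

theorem mainTheorem4 (lam kF rI rF : ℕ) (hlam : 2 ≤ lam) (hrF : 1 ≤ rF) (hk : rF ≤ kF) :
    -- the base code is MDS for evaluation points `1, θ, θ ^ 2, …` in a large enough field
    (∃ D₀ : ℕ, ∀ p D : ℕ, p.Prime → D₀ ≤ D →
      ∀ (K : Type u) [Field K] [Finite K], Nat.card K = p ^ D →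
      ∀ θ : Kˣ, (∀ x : Kˣ, x ∈ Subgroup.zpowers θ) →
        (baseCode (fun t => (θ : K) ^ t) (lam * kF) (max rI rF)).IsMDS) ∧
    -- the construction for `rF < rI`
    (rF < rI →
      ∀ (K : Type u) [Field K] [Finite K] (ξ : ℕ → K), (baseCode ξ (lam * kF) rI).IsMDS →
      ∃ C : StableSplitCode K lam kF rI rF (downAlpha lam rI rF),
        C.initialCode = downInitial ξ lam kF rI rF ∧
        C.finalCode = downFinal ξ lam kF rI rF ∧
        C.KeepsDataSymbols ∧
        C.IsMDS ∧
        (∀ s, ¬ C.IsRetired s → C.amount s = (lam - 1) * rF ∧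
          C.Reads s {ℓ | rF ≤ (ℓ : ℕ) ∧ (ℓ : ℕ) < lam * rF}) ∧
        (∀ s, C.IsRetired s → C.amount s = lam * rF ∧
          C.Reads s {ℓ | (ℓ : ℕ) < lam * rF}) ∧
        (C.readBandwidth : ℚ) = tightBound lam kF rI rF (downAlpha lam rI rF) ∧
        ∀ (K' : Type v) [Field K'] [Finite K'] (α : ℕ) (C' : StableSplitCode K' lam kF rI rF α),
          0 < α → C'.IsMDS → C'.ConjecturedInequality →
            tightBound lam kF rI rF α ≤ (C'.readBandwidth : ℚ) ∧
            (C.bandwidth : ℚ) / (downAlpha lam rI rF : ℕ) ≤ (C'.bandwidth : ℚ) / α) ∧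
    -- the construction for `rI ≤ rF`
    (rI ≤ rF →
      ∀ (K : Type u) [Field K] [Finite K] (ξ : ℕ → K), (baseCode ξ (lam * kF) rF).IsMDS →
      ∃ C : StableSplitCode K lam kF rI rF (upAlpha lam rF),
        C.initialCode = upInitial ξ lam kF rI rF ∧
        C.finalCode = upFinal ξ lam kF rF ∧
        C.KeepsDataSymbols ∧
        C.IsMDS ∧
        (∀ s, ¬ C.IsRetired s → C.amount s = lam * rF - rI ∧
          C.Reads s {ℓ | rI ≤ (ℓ : ℕ)}) ∧
        (∀ s, C.IsRetired s → C.amount s = lam * rF ∧ C.Reads s Set.univ) ∧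
        (C.readBandwidth : ℚ) = looseBound lam kF rI rF (upAlpha lam rF) ∧
        ∀ (K' : Type v) [Field K'] [Finite K'] (α : ℕ) (C' : StableSplitCode K' lam kF rI rF α),
          0 < α → C'.IsMDS →
            looseBound lam kF rI rF α ≤ (C'.readBandwidth : ℚ) ∧
            (C.bandwidth : ℚ) / (upAlpha lam rF : ℕ) ≤ (C'.bandwidth : ℚ) / α) := by
  have hlam' : 1 ≤ lam := by omega
  have hk2 : 2 ≤ lam * kF := hlam.trans (Nat.le_mul_of_pos_right _ (hrF.trans hk))
  refine ⟨isMDS_baseCode_pow_generator _ _, fun hr K _ _ ξ hbase => ?_, fun hr K _ _ ξ hbase => ?_⟩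
  · rw [isMDS_baseCode_iff] at hbase
    obtain ⟨C, h₁, h₂, h₃, h₄, h₅, h₆⟩ := exists_down_stableSplitCode (ξ := ξ) (kF := kF)
      (fun t ht => hbase.ne_zero hk2 ht) hlam' hr.le
    have hread : (C.readBandwidth : ℚ) = tightBound lam kF rI rF (downAlpha lam rI rF) := by
      rw [h₆, tightBound_downAlpha hlam' (by omega)]
    refine ⟨C, h₁, h₂, h₃, ⟨?_, ?_⟩, h₄, h₅, hread, ?_⟩
    · rw [h₁]
      exact isMDS_downInitial hbase hlam' hr.le
    · rw [h₂]
      exact isMDS_downFinal hbase hlam' hr.le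
    · intro K' _ _ α C' hα hC' hconj
      have hle := C'.tightBound_le hC'.2 hlam' hrF hk (by omega) hconj
      refine ⟨hle, C.bandwidth_div_le C' ?_ hα (hread.trans (tightBound_eq_mul ..))
        ((tightBound_eq_mul ..).symm.trans_le hle)⟩
      unfold downAlpha
      omega
  · rw [isMDS_baseCode_iff] at hbase
    obtain ⟨C, h₁, h₂, h₃, h₄, h₅, h₆⟩ := exists_up_stableSplitCode (ξ := ξ) (lam := lam) (kF := kF)
      (fun t ht => hbase.ne_zero hk2 ht) hr
    have hread : (C.readBandwidth : ℚ) = looseBound lam kF rI rF (upAlpha lam rF) := by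
      rw [h₆, looseBound_upAlpha hlam' hrF hk hr]
    refine ⟨C, h₁, h₂, h₃, ⟨?_, ?_⟩, h₄, h₅, hread, ?_⟩
    · rw [h₁]
      exact isMDS_upInitial (hbase.mono le_rfl hr) hlam' hr
    · rw [h₂]
      exact isMDS_upFinal (hbase.mono (Nat.le_mul_of_pos_left _ hlam') le_rfl)
    · intro K' _ _ α C' hα hC'
      have hle := C'.looseBound_le hC'.2 hrF hk (hr.trans (Nat.le_mul_of_pos_left _ hlam'))
      refine ⟨hle, C.bandwidth_div_le C' ?_ hα (hread.trans (looseBound_eq_mul ..))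
        ((looseBound_eq_mul ..).symm.trans_le hle)⟩
      exact Nat.mul_pos hlam' hrF
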